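/- Let $E$ and $X$ be non-empty path-connected topological spaces, with $X$ locally path-connected and semilocally simply connected (every $x \in X$ has a neighbourhood $U$ such that every loop at $x$ in $U$ is null-homotopic in $X$). For a space $Y$ and $y \in Y$ let $P(Y,y)$ be the space of paths $\alpha : [0,1] \to Y$ with $\alpha(0)=y$, with the compact-open topology, and let $ev_1 : P(Y,y) \to Y$, $ev_1(\alpha)=\alpha(1)$. Let $p : E \to X$ be a continuous map with the continuous path-covering property: for every $e \in E$, the map $P(E,e) \to P(X,p(e))$, $\alpha \mapsto p\circ\alpha$, is a homeomorphism. Let $e_0 \in E$. If $ev_1 : P(E,e_0) \to E$ is a topological quotient map, then $p$ is a covering projection, i.e. $p$ is surjective and every point of $X$ has an evenly covered open neighbourhood. The hypothesis on $ev_1$ holds, for instance, if $E$ is locally path-connected; so in that case $p$ is a covering projection. -/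

import Mathlib

open scoped unitInterval Topology

namespace PathCovering

/-- The based path space `P(X, x)`: continuous maps `α : [0, 1] → X` with `α 0 = x`, with the
subspace topology inherited from the compact-open topology on `C([0, 1], X)`. -/
abbrev PathSpace (X : Type*) [TopologicalSpace X] (x : X) : Type _ :=
  {α : C(I, X) // α 0 = x}

/-- The endpoint evaluation map `ev₁ : P(X, x) → X`, `ev₁ α = α 1`. -/
def ev₁ {X : Type*} [TopologicalSpace X] (x : X) (α : PathSpace X x) : X :=
  α.1 1

/-- The map `P(p) : P(E, e) → P(X, p e)`, `α ↦ p ∘ α`, induced by a continuous map `p`. -/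
def pathMap {E X : Type*} [TopologicalSpace E] [TopologicalSpace X] (p : C(E, X)) (e : E)
    (α : PathSpace E e) : PathSpace X (p e) :=
  ⟨p.comp α.1, congrArg p α.2⟩

/-- The continuous path-covering property: for every `e`, the induced map
`P(p) : P(E, e) → P(X, p e)` is a homeomorphism. -/
def HasContinuousPathCovering {E X : Type*} [TopologicalSpace E] [TopologicalSpace X]
    (p : C(E, X)) : Prop :=
  ∀ e : E, IsHomeomorph (pathMap p e)

/-- Semilocally simply connected: every point `x` has a neighbourhood `U` such that every loop at
`x` lying in `U` is null-homotopic (rel. endpoints) in `X`; that is, the inclusion induces the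
trivial homomorphism `π₁(U, x) → π₁(X, x)`. -/
def SemilocallySimplyConnected (X : Type*) [TopologicalSpace X] : Prop :=
  ∀ x : X, ∃ U ∈ 𝓝 x, ∀ γ : Path x x, Set.range γ ⊆ U → γ.Homotopic (Path.refl x)

/-- Covering projection: a surjective covering map (every point of the base has an evenly covered
open neighbourhood). Mathlib's `IsCoveringMap` alone would allow empty fibres. -/
def IsCoveringProjection {E X : Type*} [TopologicalSpace E] [TopologicalSpace X]
    (p : C(E, X)) : Prop :=
  IsCoveringMap p ∧ Function.Surjective p

end PathCovering

open Set Filter ContinuousMap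

namespace PathCovering

variable {E X : Type*} [TopologicalSpace E] [TopologicalSpace X]

/-! Over an elementary set `V`, the path components of `p ⁻¹' V` are the candidate sheets: `p` is
injective on each by definition and maps each onto `V` by path lifting. Elementary sets cover `X`,
because semilocal simple connectedness makes small loops null-homotopic and null-homotopies lift
(`eq_of_homotopic_refl`). Since `p` is open, all that is missing is that the sheets are open in `E`.
Their preimages under `ev₁` are open, as a small change of a path keeps its endpoint in the same
sheet (`eventually_joinedIn_ev₁`); the quotient hypothesis transfers this to `E`. -/

/-- A path, regarded as a point of the based path space. -/
def ofPath {x y : X} (γ : Path x y) : PathSpace X x :=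
  ⟨γ.toContinuousMap, γ.source⟩

theorem continuous_ev₁ (x : X) : Continuous (ev₁ x) :=
  (continuous_eval_const (1 : I)).comp continuous_subtype_val

theorem ev₁_surjective [PathConnectedSpace X] (x : X) : Function.Surjective (ev₁ x) := fun y =>
  ⟨ofPath (PathConnectedSpace.somePath x y), (PathConnectedSpace.somePath x y).target⟩

/-- A continuous map on `[0, 1]` joins its values at `s ≤ t` within any set containing its image of
`[s, t]`. -/
theorem joinedIn_of_mapsTo (α : C(I, X)) {s t : I} (hst : s ≤ t) {F : Set X}
    (h : MapsTo α (Icc s t) F) : JoinedIn F (α s) (α t) := by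
  have hI : IsPathConnected (Icc s t) := by
    rw [Topology.IsInducing.subtypeVal.isPathConnected_iff]
    have : ((↑) '' Icc s t : Set ℝ) = Icc (s : ℝ) t := by
      ext r
      constructor
      · rintro ⟨u, hu, rfl⟩
        exact hu
      · intro hr
        exact ⟨⟨r, s.2.1.trans hr.1, hr.2.trans t.2.2⟩, hr, rfl⟩
    rw [this]
    exact (convex_Icc _ _).isPathConnected ⟨_, left_mem_Icc.2 hst⟩
  exact ((hI.joinedIn s (left_mem_Icc.2 hst) t (right_mem_Icc.2 hst)).map_continuousOn
    α.continuous.continuousOn).mono h.image_subset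

/-- In a locally path-connected space, the endpoints of the paths near the constant path at `x` fill a
neighbourhood of `x`. -/
theorem ev₁_image_mem_nhds_of_const [LocallyPathConnectedSpace X] {x : X}
    {O : Set (PathSpace X x)} (hO : O ∈ 𝓝 (ofPath (Path.refl x) : PathSpace X x)) :
    ev₁ x '' O ∈ 𝓝 x := by
  obtain ⟨T, hT, hTO⟩ := mem_nhds_induced _ _ _ |>.1 hO
  obtain ⟨⟨K, N⟩, ⟨-, hN, hNc⟩, hKN⟩ :=
    (LocallyPathConnectedSpace.path_connected_basis x).nhds_continuousMapConst.mem_iff.1 hT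
  refine mem_of_superset hN fun y hy => ?_
  obtain ⟨γ, hγ⟩ := hNc.joinedIn x (mem_of_mem_nhds hN) y hy
  exact ⟨ofPath γ, hTO (hKN fun t _ => hγ t), γ.target⟩

theorem isQuotientMap_ev₁ [PathConnectedSpace X] [LocallyPathConnectedSpace X] (x : X) :
    Topology.IsQuotientMap (ev₁ x) := by
  refine (Topology.isQuotientMap_iff _).2 ⟨Topology.isCoinducing_iff.2 fun A =>
    ⟨fun hA => ?_, fun h => h.preimage (continuous_ev₁ x)⟩, ev₁_surjective x⟩
  rw [isOpen_iff_mem_nhds]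
  intro y hy
  let γ : Path x y := PathConnectedSpace.somePath x y
  -- Prepending a fixed path is continuous and preserves endpoints, which reduces the claim to
  -- neighbourhoods of a constant path.
  let τ : PathSpace X y → PathSpace X x := fun δ => ofPath (γ.trans ⟨δ.1, δ.2, rfl⟩)
  have hτ : Continuous τ := by
    refine Continuous.subtype_mk (continuous_of_continuous_uncurry _ ?_) _
    refine Path.trans_continuous_family (fun _ : PathSpace X y => γ) ?_
      (fun δ : PathSpace X y => (⟨δ.1, δ.2, rfl⟩ : Path y (δ.1 1))) ?_
    · exact γ.continuous.comp continuous_snd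
    · exact continuous_eval.comp (continuous_subtype_val.prodMap continuous_id)
  have hτ1 (δ : PathSpace X y) : ev₁ x (τ δ) = ev₁ y δ :=
    (γ.trans (⟨δ.1, δ.2, rfl⟩ : Path y (δ.1 1))).target
  have hmem : τ ⁻¹' (ev₁ x ⁻¹' A) ∈ 𝓝 (ofPath (Path.refl y) : PathSpace X y) :=
    (hA.preimage hτ).mem_nhds (by rw [mem_preimage, mem_preimage, hτ1]; exact hy)
  refine mem_of_superset (ev₁_image_mem_nhds_of_const hmem) ?_
  rintro _ ⟨δ, hδ, rfl⟩
  rwa [← hτ1]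

section Lifting

variable {p : C(E, X)}

theorem HasContinuousPathCovering.exists_joinedIn (hp : HasContinuousPathCovering p) {e : E} {y : X}
    {N : Set X} (h : JoinedIn N (p e) y) : ∃ e', JoinedIn (p ⁻¹' N) e e' ∧ p e' = y := by
  obtain ⟨γ, hγ⟩ := h
  obtain ⟨α, hα⟩ := (hp e).surjective (ofPath γ)
  have hα' (t : I) : p (α.1 t) = γ t := congrArg (fun β : PathSpace X (p e) => β.1 t) hα
  exact ⟨α.1 1, ⟨⟨α.1, α.2, rfl⟩, fun t => show p (α.1 t) ∈ N from hα' t ▸ hγ t⟩,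
    (hα' 1).trans γ.target⟩

theorem HasContinuousPathCovering.surjective [Nonempty E] [PathConnectedSpace X]
    (hp : HasContinuousPathCovering p) : Function.Surjective p := fun y =>
  let e := Classical.arbitrary E
  have ⟨e', _, he'⟩ := hp.exists_joinedIn
    (isPathConnected_univ.joinedIn (p e) (mem_univ _) y (mem_univ _))
  ⟨e', he'⟩

/-- The null-homotopy, seen as a path of paths, lifts to one from `η` to the constant path. Its
endpoints trace a lift of a constant path, hence do not move. -/
theorem HasContinuousPathCovering.eq_of_homotopic_refl (hp : HasContinuousPathCovering p) {e e' : E}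
    (η : Path e e') (h : p e = p e')
    (H : ((η.map p.continuous).cast rfl h).Homotopic (Path.refl (p e))) : e = e' := by
  obtain ⟨F⟩ := H
  let G : I → PathSpace X (p e) := fun s => ofPath (F.eval s)
  have hG : Continuous G := by
    refine Continuous.subtype_mk (continuous_of_continuous_uncurry _ ?_) _
    exact F.continuous
  let L : I → PathSpace E e := fun s => ((hp e).homeomorph _).symm (G s)
  have hL : Continuous L := ((hp e).homeomorph _).symm.continuous.comp hG
  have hpL (s : I) : pathMap p e (L s) = G s := ((hp e).homeomorph _).apply_symm_apply (G s)
  have hL0 : L 0 = ofPath η := by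
    refine (hp e).injective ((hpL 0).trans (Subtype.ext (ContinuousMap.ext fun t => ?_)))
    exact F.apply_zero t
  have hL1 : L 1 = ofPath (Path.refl e) := by
    refine (hp e).injective ((hpL 1).trans (Subtype.ext (ContinuousMap.ext fun t => ?_)))
    exact F.apply_one t
  let κ : PathSpace E e' :=
    ⟨⟨fun s => ev₁ e (L s), (continuous_ev₁ e).comp hL⟩, by simp [hL0, ev₁, ofPath]⟩
  have hκ : κ = ofPath (Path.refl e') := by
    refine (hp e').injective (Subtype.ext (ContinuousMap.ext fun s => ?_))
    have h1 : p (ev₁ e (L s)) = F.eval s 1 := congrArg (ev₁ (p e)) (hpL s)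
    exact h1.trans ((F.eval s).target.trans h)
  have hκ1 : ev₁ e (L 1) = e' := congrArg (ev₁ e') hκ
  rw [hL1] at hκ1
  exact hκ1

theorem HasContinuousPathCovering.isOpenMap [LocallyPathConnectedSpace X]
    (hp : HasContinuousPathCovering p) : IsOpenMap p := by
  rw [isOpenMap_iff_nhds_le]
  intro e U hU
  have h : ev₁ e ⁻¹' (p ⁻¹' U) ∈ 𝓝 (ofPath (Path.refl e) : PathSpace E e) :=
    (continuous_ev₁ e).continuousAt hU
  refine mem_of_superset (ev₁_image_mem_nhds_of_const ((hp e).isOpenMap.image_mem_nhds h)) ?_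
  rintro _ ⟨_, ⟨α, hα, rfl⟩, rfl⟩
  exact hα

/-- An open path-connected set over which `p` is injective on each path component. -/
structure IsElementary (p : C(E, X)) (V : Set X) : Prop where
  isOpen : IsOpen V
  isPathConnected : IsPathConnected V
  eq_of_joinedIn : ∀ {e e' : E}, JoinedIn (p ⁻¹' V) e e' → p e = p e' → e = e'

theorem SemilocallySimplyConnected.exists_isElementary [LocallyPathConnectedSpace X]
    (hX : SemilocallySimplyConnected X) (hp : HasContinuousPathCovering p) (x : X) :
    ∃ V, x ∈ V ∧ IsElementary p V := by
  obtain ⟨U, hU, hloop⟩ := hX x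
  obtain ⟨V, ⟨hVo, hxV, hVc⟩, hVU⟩ :=
    (isOpen_isPathConnected_basis x).mem_iff.1 hU
  refine ⟨V, hxV, hVo, hVc, fun {e e'} ⟨η, hη⟩ h => hp.eq_of_homotopic_refl η h ?_⟩
  -- The hypothesis concerns only loops at `x`, so the loop at `p e` is conjugated by a path `δ` in
  -- `V`.
  obtain ⟨δ, hδ⟩ := hVc.joinedIn x hxV (p e) (by simpa using hη 0)
  have hη' (t : I) : p (η t) ∈ V := hη t
  have hnull := hloop ((δ.trans ((η.map p.continuous).cast rfl h)).trans δ.symm) (by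
    rw [Path.trans_range, Path.trans_range, Path.symm_range]
    refine (union_subset (union_subset ?_ ?_) ?_).trans hVU <;> rintro _ ⟨t, rfl⟩
    exacts [hδ t, hη' t, hδ t])
  rw [← Path.Homotopic.Quotient.eq] at hnull ⊢
  simp only [Path.Homotopic.Quotient.mk_trans, Path.Homotopic.Quotient.mk_symm,
    Path.Homotopic.Quotient.mk_refl] at hnull ⊢
  generalize Path.Homotopic.Quotient.mk ((η.map p.continuous).cast rfl h) = a at hnull ⊢
  generalize Path.Homotopic.Quotient.mk δ = d at hnull
  calc a = (d.symm.trans ((d.trans a).trans d.symm)).trans d := by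
        simp only [Path.Homotopic.Quotient.trans_assoc, Path.Homotopic.Quotient.symm_trans,
          Path.Homotopic.Quotient.trans_refl]
        simp [← Path.Homotopic.Quotient.trans_assoc]
    _ = .refl (p e) := by rw [hnull]; simp

/-- If `p` is elementary near every point, the endpoint of a lifted path varies, for small changes of
the path, within a path component of the preimage of any open set around its projection. -/
theorem eventually_joinedIn_ev₁ [LocallyPathConnectedSpace X]
    (hX : ∀ x, ∃ V, x ∈ V ∧ IsElementary p V) (hp : HasContinuousPathCovering p) {e₀ : E}
    (α : PathSpace E e₀) {V : Set X} (hV : IsOpen V) (hαV : p (ev₁ e₀ α) ∈ V) :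
    ∀ᶠ β in 𝓝 α, JoinedIn (p ⁻¹' V) (ev₁ e₀ α) (ev₁ e₀ β) := by
  choose W hxW hW using hX
  obtain ⟨t, ht0, htm, ⟨n, hn⟩, ht⟩ := exists_monotone_Icc_subset_open_cover_unitInterval
    (c := fun x => α.1 ⁻¹' (p ⁻¹' W x))
    (fun x => ((hW x).isOpen.preimage p.continuous).preimage α.1.continuous)
    (fun s _ => mem_iUnion.2 ⟨p (α.1 s), hxW _⟩)
  -- `V` is quantified inside the induction because the step uses the previous case for `W x`.
  suffices h : ∀ m, ∀ V, IsOpen V → p (α.1 (t m)) ∈ V →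
      ∀ᶠ β in 𝓝 α, JoinedIn (p ⁻¹' V) (α.1 (t m)) (β.1 (t m)) by
    have := h n V hV
    rw [hn n le_rfl] at this
    exact this hαV
  intro m
  induction m with
  | zero =>
    intro V _ hm
    refine Eventually.of_forall fun β => ?_
    rw [ht0, α.2] at hm
    rw [ht0, α.2, β.2]
    exact JoinedIn.refl hm
  | succ m ih =>
    intro V hV hm
    obtain ⟨x, hx⟩ := ht m
    have hle := htm (Nat.le_succ m)
    have hmx : p (α.1 (t (m + 1))) ∈ W x := hx (right_mem_Icc.2 hle)
    let N := pathComponentIn (V ∩ W x) (p (α.1 (t (m + 1))))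
    have hN : IsOpen N := (hV.inter (hW x).isOpen).pathComponentIn _
    have h1 := ih (W x) (hW x).isOpen (hx (left_mem_Icc.2 hle))
    have h2 : ∀ᶠ β : PathSpace E e₀ in 𝓝 α, MapsTo β.1 (Icc (t m) (t (m + 1))) (p ⁻¹' W x) :=
      continuous_subtype_val.continuousAt.eventually
        (eventually_mapsTo isCompact_Icc ((hW x).isOpen.preimage p.continuous) hx)
    have h3 : ∀ᶠ β : PathSpace E e₀ in 𝓝 α, p (β.1 (t (m + 1))) ∈ N := by
      have hc : Continuous fun β : PathSpace E e₀ => p (β.1 (t (m + 1))) :=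
        p.continuous.comp ((continuous_eval_const _).comp continuous_subtype_val)
      exact hc.continuousAt.eventually
        (hN.mem_nhds (mem_pathComponentIn_self ⟨hm, hmx⟩))
    filter_upwards [h1, h2, h3] with β h1 h2 h3
    -- A path in `N` lifts to one ending at `e'`, over the same point as `β.1 (t (m + 1))` and in
    -- the same component of `p ⁻¹' W x`; hence the two agree.
    obtain ⟨e', he', hpe'⟩ := hp.exists_joinedIn h3
    have hα := joinedIn_of_mapsTo α.1 hle hx
    have hβ := joinedIn_of_mapsTo β.1 hle h2
    have hj : JoinedIn (p ⁻¹' W x) e' (β.1 (t (m + 1))) :=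
      (he'.mono (preimage_mono inter_subset_right)).symm.trans (hα.symm.trans (h1.trans hβ))
    rw [← (hW x).eq_of_joinedIn hj hpe']
    exact he'.mono (preimage_mono inter_subset_left)

theorem isOpen_pathComponentIn_preimage [LocallyPathConnectedSpace X]
    (hX : ∀ x, ∃ V, x ∈ V ∧ IsElementary p V) (hp : HasContinuousPathCovering p) {e₀ : E}
    (hq : Topology.IsQuotientMap (ev₁ e₀)) {V : Set X} (hV : IsOpen V) (e : E) :
    IsOpen (pathComponentIn (p ⁻¹' V) e) := by
  rw [← hq.isOpen_preimage, isOpen_iff_mem_nhds]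
  intro α hα
  filter_upwards [eventually_joinedIn_ev₁ hX hp α hV
    (show _ ∈ p ⁻¹' V from pathComponentIn_subset hα)] with β hβ
  exact JoinedIn.trans hα hβ

theorem IsElementary.isEvenlyCovered [LocallyPathConnectedSpace X] {V : Set X}
    (hV : IsElementary p V) (hp : HasContinuousPathCovering p) (hsurj : Function.Surjective p)
    (hopen : ∀ e, IsOpen (pathComponentIn (p ⁻¹' V) e)) {x : X} (hx : x ∈ V) :
    IsEvenlyCovered p x (p ⁻¹' {x}) := by
  let U : p ⁻¹' {x} → Set E := fun e => pathComponentIn (p ⁻¹' V) e.1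
  have hself (e : p ⁻¹' {x}) : e.1 ∈ U e :=
    mem_pathComponentIn_self (show p e.1 ∈ V by rwa [show p e.1 = x from e.2])
  have hfib {e e' : p ⁻¹' {x}} (h : JoinedIn (p ⁻¹' V) e.1 e'.1) : e = e' :=
    Subtype.ext (hV.eq_of_joinedIn h ((show p e.1 = x from e.2).trans (Eq.symm e'.2)))
  -- Each open sheet meets the fibre in exactly one point.
  have : DiscreteTopology (p ⁻¹' {x}) := by
    refine discreteTopology_iff_isOpen_singleton.2 fun e => ?_
    convert (hopen e.1).preimage continuous_subtype_val using 1
    ext e'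
    exact ⟨fun h => h ▸ hself e, fun h => (hfib h).symm⟩
  have : Nonempty (p ⁻¹' {x}) := let ⟨e, he⟩ := hsurj x; ⟨⟨e, he⟩⟩
  have : Nonempty (X → E) := ⟨Function.surjInv hsurj⟩
  have hsurjOn (e : p ⁻¹' {x}) : SurjOn p (U e) V := fun y hy => by
    have he : e.1 ∈ p ⁻¹' V := pathComponentIn_subset (hself e)
    obtain ⟨e', he', hpe'⟩ := hp.exists_joinedIn (hV.isPathConnected.joinedIn (p e.1) he y hy)
    exact ⟨e', he', hpe'⟩
  refine .of_trivialization (t := hV.isOpen.trivializationDiscrete U V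
    (fun e W hW => ⟨fun h => (h.preimage p.continuous).inter (hopen e.1), fun h => ?_⟩)
    (fun e a ha b hb hab => hV.eq_of_joinedIn (JoinedIn.trans (JoinedIn.symm ha) hb) hab)
    hsurjOn ?_ ?_) hx
  · convert hp.isOpenMap _ h using 1
    refine Subset.antisymm (fun y hy => ?_) (image_subset_iff.2 inter_subset_left)
    obtain ⟨e', he', rfl⟩ := hsurjOn e (hW hy)
    exact ⟨e', ⟨hy, he'⟩, rfl⟩
  · intro e e' hne
    exact disjoint_left.2 fun a ha ha' => hne (hfib (JoinedIn.trans ha (JoinedIn.symm ha')))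
  · intro a ha
    obtain ⟨e, he, hpe⟩ := hp.exists_joinedIn (hV.isPathConnected.joinedIn (p a) ha x hx)
    exact mem_iUnion.2 ⟨⟨e, hpe⟩, he.symm⟩

end Lifting

theorem HasContinuousPathCovering.isCoveringProjection [Nonempty E] [PathConnectedSpace X]
    [LocallyPathConnectedSpace X] {p : C(E, X)} (hX : SemilocallySimplyConnected X)
    (hp : HasContinuousPathCovering p) {e₀ : E} (hq : Topology.IsQuotientMap (ev₁ e₀)) :
    IsCoveringProjection p := by
  have hel := hX.exists_isElementary hp
  refine ⟨fun x => ?_, hp.surjective⟩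
  obtain ⟨V, hxV, hV⟩ := hel x
  exact hV.isEvenlyCovered hp hp.surjective
    (isOpen_pathComponentIn_preimage hel hp hq hV.isOpen) hxV

end PathCovering

theorem corollary4p3 {E X : Type*} [TopologicalSpace E] [TopologicalSpace X]
    [PathConnectedSpace E] [PathConnectedSpace X] [LocallyPathConnectedSpace X]
    (hX : PathCovering.SemilocallySimplyConnected X) (p : C(E, X))
    (hp : PathCovering.HasContinuousPathCovering p) (e₀ : E) :
    (Topology.IsQuotientMap (PathCovering.ev₁ e₀) → PathCovering.IsCoveringProjection p) ∧
      (LocallyPathConnectedSpace E →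
        Topology.IsQuotientMap (PathCovering.ev₁ e₀) ∧ PathCovering.IsCoveringProjection p) :=
  ⟨fun hq => hp.isCoveringProjection hX hq, fun _ =>
    ⟨PathCovering.isQuotientMap_ev₁ e₀,
      hp.isCoveringProjection hX (PathCovering.isQuotientMap_ev₁ e₀)⟩⟩
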